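/- Let $a,b\in\mathbb{R}$ and put $$\omega=\frac{a-1}{2},\qquad \kappa_n=\frac{n^2(n^2+4b-a^2)}{4(2n-1)(2n+1)}\quad(n\ge 1).$$ For $x\in\mathbb{C}$ consider the continued fraction $$F(x)=F(a,b;x)=\cfrac{1}{x+\omega+\cfrac{\kappa_1}{x+\omega+\cfrac{\kappa_2}{x+\omega+\cdots}}},$$ whose value is the limit of its approximants $A_n/B_n$ (with numerators and denominators given by the standard three-term recurrences); if some $\kappa_N=0$, with $N$ least, it terminates, and its value is the finite continued fraction that uses only $\kappa_1,\dots,\kappa_{N-1}$. Assume that $x\neq q+\alpha$ for every integer $q\le 0$ and every complex root $\alpha$ of $\alpha^2+a\alpha+b=0$. If either $\sqrt{a^2-4b}$ is a positive integer, or $\Re x>-\omega$, then the continued fractions $F(x)$ and $F(x+1)$ have finite values, and $$F(x)-F(x+1)=\frac{1}{x^2+ax+b}.$$ -/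

import Mathlib

open Filter Topology

open scoped Classical in
/-- The generalized continued fraction
`b₀ + a 0 / (b 0 + a 1 / (b 1 + a 2 / (b 2 + ⋯)))`, with the convention that it terminates just
before the first vanishing partial numerator: if `a N = 0` and `a n ≠ 0` for all `n < N`, only the
pairs `(a n, b n)` with `n < N` are kept. -/
noncomputable def contFrac (b₀ : ℂ) (a b : ℕ → ℂ) : GenContFract ℂ where
  h := b₀
  s := ⟨fun n => if ∃ k ≤ n, a k = 0 then none else some ⟨a n, b n⟩, by
    intro n hn
    have h : ∃ k ≤ n, a k = 0 := by
      by_contra h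
      simp [h] at hn
    obtain ⟨k, hk, hk0⟩ := h
    exact if_pos ⟨k, hk.trans n.le_succ, hk0⟩⟩

/-- The continued fraction `g` has the (finite) value `τ`: its approximants `Aₙ / Bₙ` are defined
for all large `n` and tend to `τ`. For a terminating continued fraction the sequence `Aₙ / Bₙ` is
eventually constant, and `τ` is the last approximant. -/
def HasValue (g : GenContFract ℂ) (τ : ℂ) : Prop :=
  (∀ᶠ n in atTop, g.dens n ≠ 0) ∧ Tendsto g.convs atTop (𝓝 τ)

/-- `ω = (a - 1) / 2`. -/
noncomputable def omegaPt (a : ℝ) : ℝ := (a - 1) / 2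

/-- `κₙ = n² (n² + 4 b - a²) / (4 (2 n - 1) (2 n + 1))`, used for `n ≥ 1`. -/
noncomputable def kappa (a b : ℝ) (n : ℕ) : ℝ :=
  (n : ℝ) ^ 2 * ((n : ℝ) ^ 2 + 4 * b - a ^ 2) / (4 * (2 * (n : ℝ) - 1) * (2 * (n : ℝ) + 1))

/-- The partial numerators `1, κ₁, κ₂, …`. -/
noncomputable def typeINum (a b : ℝ) : ℕ → ℂ
  | 0 => 1
  | n + 1 => (kappa a b (n + 1) : ℂ)

/-- The continued fraction `1 / (x + ω + κ₁ / (x + ω + κ₂ / (x + ω + ⋯)))`. -/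
noncomputable def typeI (a b : ℝ) (x : ℂ) : GenContFract ℂ :=
  contFrac 0 (typeINum a b) (fun _ => x + (omegaPt a : ℂ))

/-- `F(a, b; x)`: the limit of the approximants of the continued fraction `typeI a b x`
(meaningful when the latter has a value). -/
noncomputable def F (a b : ℝ) (x : ℂ) : ℂ :=
  limUnder atTop (typeI a b x).convs

/-! With z = x + ω, a solution u of the backward recurrence (`IsBackward`) has as ratios u n / u
(n+1) candidate tails of the continued fraction, suggesting the value u 1 / u 0. Two facts make this
work.

Convergence: if those ratios eventually lie in the closed right half-plane and Re z > 0, the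
approximants tend to u 1 / u 0 (`cfDen_ne_zero_and_tendsto`), because a Christoffel–Darboux sum
diverges. A terminating fraction needs only u 0 ≠ 0.

Contiguity: an explicit 2×2 map carries a tail at z + 1 to one at z and adds 1/q to u 1 / u 0, where
q = x² + ax + b (`IsTail.shift`). This is the asserted difference. The same map, iterated from z + m
with m large, where compactness gives a tail (`exists_isBackward`), yields tails at every admissible
z. -/

/-- The solution of `X (n + 2) = z * X (n + 1) + κ (n + 1) * X n` with given initial values. -/
noncomputable def linRec (z : ℂ) (κ : ℕ → ℝ) (X₀ X₁ : ℂ) : ℕ → ℂ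
  | 0 => X₀
  | 1 => X₁
  | n + 2 => z * linRec z κ X₀ X₁ (n + 1) + (κ (n + 1) : ℂ) * linRec z κ X₀ X₁ n

theorem linRec_zero (z : ℂ) (κ : ℕ → ℝ) (X₀ X₁ : ℂ) : linRec z κ X₀ X₁ 0 = X₀ := by
  rw [linRec]

theorem linRec_one (z : ℂ) (κ : ℕ → ℝ) (X₀ X₁ : ℂ) : linRec z κ X₀ X₁ 1 = X₁ := by
  rw [linRec]

theorem linRec_add_two (z : ℂ) (κ : ℕ → ℝ) (X₀ X₁ : ℂ) (n : ℕ) :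
    linRec z κ X₀ X₁ (n + 2) =
      z * linRec z κ X₀ X₁ (n + 1) + (κ (n + 1) : ℂ) * linRec z κ X₀ X₁ n := by
  rw [linRec]

/-- Canonical numerators of `1 / (z + κ 1 / (z + κ 2 / (z + ⋯)))`. -/
noncomputable def cfNum (z : ℂ) (κ : ℕ → ℝ) : ℕ → ℂ := linRec z κ 0 1

/-- Canonical denominators of `1 / (z + κ 1 / (z + κ 2 / (z + ⋯)))`. -/
noncomputable def cfDen (z : ℂ) (κ : ℕ → ℝ) : ℕ → ℂ := linRec z κ 1 z

/-- `u` solves the backward recurrence satisfied by the tails of the continued fraction. -/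
def IsBackward (z : ℂ) (κ : ℕ → ℝ) (u : ℕ → ℂ) : Prop :=
  ∀ n, u n = z * u (n + 1) + (κ (n + 1) : ℂ) * u (n + 2)

/-! ### Determinant and pairing identities -/

theorem cfNum_mul_cfDen_sub (z : ℂ) (κ : ℕ → ℝ) (n : ℕ) :
    cfNum z κ (n + 1) * cfDen z κ n - cfDen z κ (n + 1) * cfNum z κ n =
      (-1) ^ n * ((∏ j ∈ Finset.range n, κ (j + 1) : ℝ) : ℂ) := by
  induction n with
  | zero => simp [cfNum, cfDen, linRec_zero, linRec_one]
  | succ n ih =>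
    rw [Finset.prod_range_succ]
    simp only [cfNum, cfDen, linRec_add_two] at ih ⊢
    push_cast at ih ⊢
    rw [pow_succ]
    linear_combination (-(κ (n + 1) : ℂ)) * ih

theorem IsBackward.zero_eq {z : ℂ} {κ : ℕ → ℝ} {u : ℕ → ℂ} (hu : IsBackward z κ u) (n : ℕ) :
    u 0 = cfDen z κ (n + 1) * u (n + 1) + (κ (n + 1) : ℂ) * cfDen z κ n * u (n + 2) := by
  induction n with
  | zero => simpa [cfDen, linRec_zero, linRec_one] using hu 0
  | succ n ih =>
    rw [ih, hu (n + 1)]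
    simp only [cfDen, linRec_add_two]
    ring

theorem IsBackward.one_eq {z : ℂ} {κ : ℕ → ℝ} {u : ℕ → ℂ} (hu : IsBackward z κ u) (n : ℕ) :
    u 1 = cfNum z κ (n + 1) * u (n + 1) + (κ (n + 1) : ℂ) * cfNum z κ n * u (n + 2) := by
  induction n with
  | zero => simp [cfNum, linRec_zero, linRec_one]
  | succ n ih =>
    rw [ih, hu (n + 1)]
    simp only [cfNum, linRec_add_two]
    ring

/-! ### Convergence for positive partial numerators -/

/-- The Christoffel–Darboux-type quantity controlling the speed of convergence. -/
noncomputable def cfGap (z : ℂ) (κ : ℕ → ℝ) (n : ℕ) : ℝ :=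
  (cfDen z κ (n + 1) * (starRingEnd ℂ) (cfDen z κ n)).re / ∏ j ∈ Finset.range n, κ (j + 1)

theorem cfGap_zero (z : ℂ) (κ : ℕ → ℝ) : cfGap z κ 0 = z.re := by
  simp [cfGap, cfDen, linRec_zero, linRec_one]

/-- Multiply the recurrence by the conjugate of the middle denominator and take real parts;
conjugating the last product leaves its real part unchanged. -/
theorem cfGap_succ (z : ℂ) {κ : ℕ → ℝ} (hκ : ∀ n, 0 < κ (n + 1)) (n : ℕ) :
    cfGap z κ (n + 1) = cfGap z κ n +
      z.re * (‖cfDen z κ (n + 1)‖ ^ 2 / ∏ j ∈ Finset.range (n + 1), κ (j + 1)) := by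
  have hP : (0 : ℝ) < ∏ j ∈ Finset.range n, κ (j + 1) := Finset.prod_pos fun j _ => hκ j
  have hk := hκ n
  rw [← Complex.normSq_eq_norm_sq]
  simp only [cfGap, cfDen, linRec_add_two, Finset.prod_range_succ, Complex.normSq_apply]
  simp only [Complex.mul_re, Complex.add_re, Complex.conj_re, Complex.conj_im, Complex.ofReal_re,
    Complex.ofReal_im, Complex.mul_im, Complex.add_im]
  field_simp
  ring

theorem monotone_cfGap {z : ℂ} (hz : 0 < z.re) {κ : ℕ → ℝ} (hκ : ∀ n, 0 < κ (n + 1)) :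
    Monotone (cfGap z κ) := by
  refine monotone_nat_of_le_succ fun n => ?_
  rw [cfGap_succ z hκ]
  have hP : (0 : ℝ) < ∏ j ∈ Finset.range (n + 1), κ (j + 1) := Finset.prod_pos fun j _ => hκ j
  have : 0 ≤ z.re * (‖cfDen z κ (n + 1)‖ ^ 2 / ∏ j ∈ Finset.range (n + 1), κ (j + 1)) := by
    positivity
  linarith

theorem re_le_cfGap {z : ℂ} (hz : 0 < z.re) {κ : ℕ → ℝ} (hκ : ∀ n, 0 < κ (n + 1)) (n : ℕ) :
    z.re ≤ cfGap z κ n := by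
  simpa [cfGap_zero] using monotone_cfGap hz hκ (Nat.zero_le n)

theorem cfDen_ne_zero {z : ℂ} (hz : 0 < z.re) {κ : ℕ → ℝ} (hκ : ∀ n, 0 < κ (n + 1)) (n : ℕ) :
    cfDen z κ n ≠ 0 := by
  intro h
  have := re_le_cfGap hz hκ n
  simp [cfGap, h] at this
  linarith

/-- AM–GM on two consecutive increments: their cross term dominates `cfGap z κ (n + 1)`, hence z.re.
-/
theorem cfGap_add_two_sub {z : ℂ} (hz : 0 < z.re) {κ : ℕ → ℝ} (hκ : ∀ n, 0 < κ (n + 1))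
    {n : ℕ} {s : ℝ} (hs : 0 < s) (hκs : κ (n + 2) ≤ s ^ 2) :
    2 * z.re ^ 2 / s ≤ cfGap z κ (n + 2) - cfGap z κ n := by
  have hP : (0 : ℝ) < ∏ j ∈ Finset.range (n + 1), κ (j + 1) := Finset.prod_pos fun j _ => hκ j
  have hk := hκ (n + 1)
  have hG := re_le_cfGap hz hκ (n + 1)
  rw [cfGap_succ z hκ (n + 1), cfGap_succ z hκ n, Finset.prod_range_succ _ (n + 1)]
  set P := ∏ j ∈ Finset.range (n + 1), κ (j + 1)
  have hre : cfGap z κ (n + 1) ≤ ‖cfDen z κ (n + 2)‖ * ‖cfDen z κ (n + 1)‖ / P := by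
    rw [cfGap]
    refine div_le_div_of_nonneg_right ?_ hP.le
    refine (Complex.re_le_norm _).trans ?_
    rw [norm_mul, RCLike.norm_conj]
  set p := ‖cfDen z κ (n + 2)‖
  set r := ‖cfDen z κ (n + 1)‖
  have h1 : p ^ 2 / (P * s ^ 2) ≤ p ^ 2 / (P * κ (n + 1 + 1)) := by
    gcongr
  have h2 : 2 * (p * r / P) / s ≤ p ^ 2 / (P * s ^ 2) + r ^ 2 / P := by
    have : p ^ 2 / (P * s ^ 2) + r ^ 2 / P - 2 * (p * r / P) / s = (p / s - r) ^ 2 / P := by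
      field_simp
      ring
    have h3 : 0 ≤ (p / s - r) ^ 2 / P := by positivity
    linarith
  have h4 : 2 * z.re / s ≤ 2 * (p * r / P) / s := by
    gcongr
    exact hG.trans hre
  have h5 : 2 * z.re / s ≤ p ^ 2 / (P * κ (n + 1 + 1)) + r ^ 2 / P := by linarith
  have h6 := mul_le_mul_of_nonneg_left h5 hz.le
  have h7 : z.re * (2 * z.re / s) = 2 * z.re ^ 2 / s := by ring
  linarith

theorem tendsto_cfGap {z : ℂ} (hz : 0 < z.re) {κ : ℕ → ℝ} (hκ : ∀ n, 0 < κ (n + 1))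
    {C : ℝ} (hC : 0 < C) (hκC : ∀ n : ℕ, κ (n + 2) ≤ (C * ((n : ℝ) + 1)) ^ 2) :
    Tendsto (cfGap z κ) atTop atTop := by
  have key : ∀ n : ℕ, (2 * z.re ^ 2 / C) * ∑ i ∈ Finset.range n, 1 / ((i : ℝ) + 1) ≤
      2 * cfGap z κ (n + 1) := by
    intro n
    -- The two-step increments telescope to this sum of neighbours; s linear in n produces the
    -- harmonic series.
    have h : (2 * z.re ^ 2 / C) * ∑ i ∈ Finset.range n, 1 / ((i : ℝ) + 1) ≤
        cfGap z κ (n + 1) + cfGap z κ n := by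
      induction n with
      | zero =>
        have h0 := re_le_cfGap hz hκ 0
        have h1 := re_le_cfGap hz hκ 1
        simp only [Finset.range_zero, Finset.sum_empty, mul_zero, zero_add]
        linarith
      | succ n ih =>
        rw [Finset.sum_range_succ, mul_add]
        have := cfGap_add_two_sub hz hκ (s := C * ((n : ℝ) + 1)) (by positivity) (hκC n)
        have e : 2 * z.re ^ 2 / (C * ((n : ℝ) + 1)) = 2 * z.re ^ 2 / C * (1 / ((n : ℝ) + 1)) := by
          field_simp
        rw [e] at this
        have e2 : cfGap z κ (n + 1 + 1) = cfGap z κ (n + 2) := rfl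
        linarith
    have := monotone_cfGap hz hκ (Nat.le_succ n)
    simp only [Nat.succ_eq_add_one] at this
    linarith
  have h1 : Tendsto (fun n : ℕ => (2 * z.re ^ 2 / C) * ∑ i ∈ Finset.range n, 1 / ((i : ℝ) + 1))
      atTop atTop :=
    Real.tendsto_sum_range_one_div_nat_succ_atTop.const_mul_atTop (by positivity)
  have h2 := tendsto_atTop_mono key h1
  have h3 : Tendsto (fun n => cfGap z κ (n + 1)) atTop atTop := by
    simpa using h2.const_mul_atTop (show (0 : ℝ) < 1 / 2 by norm_num)
  exact (tendsto_add_atTop_iff_nat 1).1 h3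

theorem norm_cfNum_div_cfDen_sub_le {z : ℂ} (hz : 0 < z.re) {κ : ℕ → ℝ}
    (hκ : ∀ n, 0 < κ (n + 1)) {u : ℕ → ℂ} (hu : IsBackward z κ u) (hu0 : ∀ n, u n ≠ 0)
    (hpos : ∀ n, 0 ≤ (u n / u (n + 1)).re) (n : ℕ) :
    ‖cfNum z κ (n + 1) / cfDen z κ (n + 1) - u 1 / u 0‖ ≤ (cfGap z κ n)⁻¹ := by
  have hP : (0 : ℝ) < ∏ j ∈ Finset.range n, κ (j + 1) := Finset.prod_pos fun j _ => hκ j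
  have hk := hκ n
  have hG : 0 < cfGap z κ n := hz.trans_le (re_le_cfGap hz hκ n)
  have hB := cfDen_ne_zero hz hκ (n + 1)
  have hW := cfNum_mul_cfDen_sub z κ n
  have e0 := hu.zero_eq n
  have e1 := hu.one_eq n
  have hGdef : (cfDen z κ (n + 1) * (starRingEnd ℂ) (cfDen z κ n)).re =
      cfGap z κ n * ∏ j ∈ Finset.range n, κ (j + 1) := by
    rw [cfGap]
    field_simp
  set P := ∏ j ∈ Finset.range n, κ (j + 1)
  set B := cfDen z κ (n + 1)
  set B' := cfDen z κ n
  set A := cfNum z κ (n + 1)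
  set A' := cfNum z κ n
  have hu2 := hu0 (n + 2)
  have hu00 := hu0 0
  have herr : A / B - u 1 / u 0 = (-1) ^ n * (P : ℂ) * (κ (n + 1) : ℂ) * u (n + 2) / (B * u 0) := by
    rw [div_sub_div _ _ hB hu00]
    congr 1
    linear_combination A * e0 - B * e1 + (κ (n + 1) : ℂ) * u (n + 2) * hW
  -- Divide `e0` by u (n+2) and multiply by conj B: the first term has nonnegative real part by
  -- `hpos`, the second contributes the gap.
  have hlow : κ (n + 1) * (cfGap z κ n * P) ≤ ‖u 0 / u (n + 2)‖ * ‖B‖ := by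
    have e : u 0 / u (n + 2) * (starRingEnd ℂ) B =
        (u (n + 1) / u (n + 2)) * ((‖B‖ ^ 2 : ℝ) : ℂ) +
          (κ (n + 1) : ℂ) * (B' * (starRingEnd ℂ) B) := by
      have : B * (starRingEnd ℂ) B = ((‖B‖ ^ 2 : ℝ) : ℂ) := by
        rw [Complex.mul_conj, Complex.normSq_eq_norm_sq]
      rw [← this, e0]
      field_simp
    have hre : κ (n + 1) * (cfGap z κ n * P) ≤ (u 0 / u (n + 2) * (starRingEnd ℂ) B).re := by
      rw [e, Complex.add_re, Complex.re_mul_ofReal, Complex.re_ofReal_mul, ← hGdef]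
      have h1 : (B' * (starRingEnd ℂ) B).re = (B * (starRingEnd ℂ) B').re := by
        simp only [Complex.mul_re, Complex.conj_re, Complex.conj_im]
        ring
      rw [h1]
      have h2 := mul_nonneg (hpos (n + 1)) (sq_nonneg ‖B‖)
      linarith
    refine hre.trans ((Complex.re_le_norm _).trans ?_)
    rw [norm_mul, RCLike.norm_conj]
  have hBn : 0 < ‖B‖ := norm_pos_iff.2 hB
  have hu0n : 0 < ‖u 0‖ := norm_pos_iff.2 hu00
  have hu2n : 0 < ‖u (n + 2)‖ := norm_pos_iff.2 hu2
  rw [herr]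
  simp only [norm_div, norm_mul, norm_pow, norm_neg, norm_one, one_pow, one_mul,
    Complex.norm_real, Real.norm_eq_abs, abs_of_pos hP, abs_of_pos hk] at hlow ⊢
  rw [div_mul_eq_mul_div, le_div_iff₀ hu2n] at hlow
  rw [div_le_iff₀ (by positivity), inv_mul_eq_div, le_div_iff₀ hG]
  linarith

/-- Pincherle-type convergence for positive partial numerators of at most quadratic growth. -/
theorem tendsto_cfNum_div_cfDen_of_pos {z : ℂ} (hz : 0 < z.re) {κ : ℕ → ℝ}
    (hκ : ∀ n, 0 < κ (n + 1)) {C : ℝ} (hC : 0 < C)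
    (hκC : ∀ n : ℕ, κ (n + 2) ≤ (C * ((n : ℝ) + 1)) ^ 2) {u : ℕ → ℂ}
    (hu : IsBackward z κ u) (hu0 : ∀ n, u n ≠ 0) (hpos : ∀ n, 0 ≤ (u n / u (n + 1)).re) :
    Tendsto (fun n => cfNum z κ n / cfDen z κ n) atTop (𝓝 (u 1 / u 0)) := by
  refine (tendsto_add_atTop_iff_nat 1).1 ?_
  rw [tendsto_iff_norm_sub_tendsto_zero]
  exact squeeze_zero (fun _ => norm_nonneg _) (norm_cfNum_div_cfDen_sub_le hz hκ hu hu0 hpos)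
    (tendsto_cfGap hz hκ hC hκC).inv_tendsto_atTop

/-! ### Discarding finitely many levels, and termination -/

theorem linRec_add (z : ℂ) (κ : ℕ → ℝ) (X₀ X₁ : ℂ) (N n : ℕ) :
    linRec z κ X₀ X₁ (N + 1 + n) =
      linRec z κ X₀ X₁ (N + 1) * cfDen z (fun j => κ (N + 1 + j)) n +
        (κ (N + 1) : ℂ) * linRec z κ X₀ X₁ N * cfNum z (fun j => κ (N + 1 + j)) n := by
  induction n using Nat.twoStepInduction with
  | zero => simp [cfNum, cfDen, linRec_zero]
  | one =>
    simp only [cfNum, cfDen, linRec_one, linRec_add_two]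
    ring
  | more n ih1 ih2 =>
    rw [show N + 1 + (n + 2) = (N + 1 + n) + 2 by ring, linRec_add_two, ih1,
      show N + 1 + n + 1 = N + 1 + (n + 1) by ring, ih2]
    simp only [cfNum, cfDen, linRec_add_two]
    ring

theorem cfDen_ne_zero_and_tendsto {z : ℂ} (hz : 0 < z.re) {κ : ℕ → ℝ}
    (hκ : ∀ᶠ n in atTop, 0 < κ n) {C : ℝ} (hC : 0 < C)
    (hκC : ∀ n : ℕ, κ (n + 1) ≤ (C * ((n : ℝ) + 1)) ^ 2) {u : ℕ → ℂ}
    (hu : IsBackward z κ u) (hu0 : u 0 ≠ 0)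
    (hpos : ∀ᶠ n in atTop, u (n + 1) ≠ 0 ∧ 0 ≤ (u n / u (n + 1)).re) :
    (∀ᶠ n in atTop, cfDen z κ n ≠ 0) ∧
      Tendsto (fun n => cfNum z κ n / cfDen z κ n) atTop (𝓝 (u 1 / u 0)) := by
  obtain ⟨N, hN⟩ := eventually_atTop.1 (hκ.and hpos)
  set κ' : ℕ → ℝ := fun j => κ (N + 1 + j) with hκ'
  set u' : ℕ → ℂ := fun j => u (N + 1 + j) with hu'
  have hu'0 : ∀ n, u' n ≠ 0 := fun n => by
    have := (hN (N + n) (by omega)).2.1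
    rwa [show N + n + 1 = N + 1 + n by ring] at this
  have hκ'pos : ∀ n, 0 < κ' (n + 1) := fun n => (hN (N + 1 + (n + 1)) (by omega)).1
  have hlim := tendsto_cfNum_div_cfDen_of_pos hz (κ := κ') (u := u') hκ'pos
    -- Absorbs the index shift: N + n + 3 ≤ (N + 3)(n + 1).
    (C := C * (N + 3)) (by positivity) ?_ (fun n => hu (N + 1 + n)) hu'0
    (fun n => (hN (N + 1 + n) (by omega)).2.2)
  · have hD := cfDen_ne_zero hz hκ'pos
    have e0 := hu.zero_eq N
    have e1 := hu.one_eq N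
    have huN : u (N + 1) ≠ 0 := hu'0 0
    have ht : u' 1 / u' 0 = u (N + 2) / u (N + 1) := rfl
    rw [ht] at hlim
    have fnum : ∀ n, cfNum z κ (n + (N + 1)) / cfDen z κ' n = cfNum z κ (N + 1) +
        (κ (N + 1) : ℂ) * cfNum z κ N * (cfNum z κ' n / cfDen z κ' n) := fun n => by
      have := linRec_add z κ 0 1 N n
      have hDn := hD n
      rw [add_comm n, cfNum, this]
      simp only [cfNum, cfDen, hκ'] at hDn ⊢
      field_simp
    have fden : ∀ n, cfDen z κ (n + (N + 1)) / cfDen z κ' n = cfDen z κ (N + 1) +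
        (κ (N + 1) : ℂ) * cfDen z κ N * (cfNum z κ' n / cfDen z κ' n) := fun n => by
      have := linRec_add z κ 1 z N n
      have hDn := hD n
      rw [add_comm n, cfDen, this]
      simp only [cfNum, cfDen, hκ'] at hDn ⊢
      field_simp
    have tnum : Tendsto (fun n => cfNum z κ (n + (N + 1)) / cfDen z κ' n) atTop
        (𝓝 (u 1 / u (N + 1))) := by
      simp only [fnum]
      have : u 1 / u (N + 1) = cfNum z κ (N + 1) +
          (κ (N + 1) : ℂ) * cfNum z κ N * (u (N + 2) / u (N + 1)) := by
        rw [e1]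
        field_simp
      rw [this]
      exact (hlim.const_mul _).const_add _
    have tden : Tendsto (fun n => cfDen z κ (n + (N + 1)) / cfDen z κ' n) atTop
        (𝓝 (u 0 / u (N + 1))) := by
      simp only [fden]
      have : u 0 / u (N + 1) = cfDen z κ (N + 1) +
          (κ (N + 1) : ℂ) * cfDen z κ N * (u (N + 2) / u (N + 1)) := by
        rw [e0]
        field_simp
      rw [this]
      exact (hlim.const_mul _).const_add _
    have hne : u 0 / u (N + 1) ≠ 0 := div_ne_zero hu0 huN
    constructor
    · have h1 := tden.eventually_ne hne
      have h2 : ∀ᶠ n in atTop, cfDen z κ (n + (N + 1)) ≠ 0 := h1.mono fun n hn h0 => by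
        simp [h0] at hn
      obtain ⟨M, hM⟩ := eventually_atTop.1 h2
      refine eventually_atTop.2 ⟨M + (N + 1), fun n hn => ?_⟩
      have := hM (n - (N + 1)) (by omega)
      rwa [Nat.sub_add_cancel (by omega)] at this
    · refine (tendsto_add_atTop_iff_nat (N + 1)).1 ?_
      have h3 := tnum.div tden hne
      have e : u 1 / u (N + 1) / (u 0 / u (N + 1)) = u 1 / u 0 := by field_simp
      rw [e] at h3
      refine h3.congr fun n => ?_
      exact div_div_div_cancel_right₀ (hD n) _ _
  · intro n
    have h1 := hκC (N + n + 2)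
    have h2 : κ' (n + 2) = κ (N + n + 2 + 1) := by
      simp only [hκ']
      congr 1
      ring
    rw [h2]
    refine h1.trans ?_
    have : ((N + n + 2 : ℕ) : ℝ) + 1 ≤ ((N : ℝ) + 3) * ((n : ℝ) + 1) := by
      push_cast
      have : 0 ≤ (N : ℝ) * n := by positivity
      have : 0 ≤ (n : ℝ) := by positivity
      linarith
    rw [mul_assoc]
    gcongr

theorem IsBackward.cfDen_ne_zero_of_eq_zero {z : ℂ} {κ : ℕ → ℝ} {u : ℕ → ℂ}
    (hu : IsBackward z κ u) (hu0 : u 0 ≠ 0) {k : ℕ} (hk : κ (k + 1) = 0) :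
    cfDen z κ (k + 1) ≠ 0 ∧ cfNum z κ (k + 1) / cfDen z κ (k + 1) = u 1 / u 0 := by
  have e0 := hu.zero_eq k
  have e1 := hu.one_eq k
  simp only [hk, Complex.ofReal_zero, zero_mul, add_zero] at e0 e1
  rw [e0] at hu0
  have := left_ne_zero_of_mul hu0
  have := right_ne_zero_of_mul hu0
  refine ⟨left_ne_zero_of_mul hu0, ?_⟩
  rw [e0, e1]
  field_simp

/-! ### Existence of backward solutions by compactness -/

/-- Backward solutions exist when every partial numerator is bounded below in terms of `z.re`. -/
theorem exists_isBackward {z : ℂ} (hz : 0 < z.re) {κ : ℕ → ℝ}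
    (hκ : ∀ n, -(z.re ^ 2 / 4) ≤ κ (n + 1)) :
    ∃ u : ℕ → ℂ, IsBackward z κ u ∧ (∀ n, u n ≠ 0) ∧ ∀ n, 0 ≤ (u n / u (n + 1)).re := by
  -- The radius bounds |κ (n+1) / w| when Re w ≥ z.re / 2, so w ↦ z + κ (n+1) / w maps K (n+1) into
  -- K n.
  let K : ℕ → Set ℂ := fun n =>
    Metric.closedBall z (2 * |κ (n + 1)| / z.re) ∩ {w | z.re / 2 ≤ w.re}
  have hKc : ∀ n, IsCompact (K n) := fun n =>
    (isCompact_closedBall _ _).inter_right (isClosed_le continuous_const Complex.continuous_re)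
  have hne : ∀ {n : ℕ} {w : ℂ}, w ∈ K n → w ≠ 0 := by
    rintro n w ⟨-, hw⟩ rfl
    simp only [Set.mem_ofPred_eq, Complex.zero_re] at hw
    linarith
  have hstep : ∀ {n : ℕ} {w : ℂ}, w ∈ K (n + 1) → z + κ (n + 1) / w ∈ K n := by
    intro n w hw
    have hw0 := hne hw
    have hwre : z.re / 2 ≤ w.re := hw.2
    have hwn : z.re / 2 ≤ ‖w‖ := hwre.trans (Complex.re_le_norm w)
    have hbd : ‖(κ (n + 1) : ℂ) / w‖ ≤ 2 * |κ (n + 1)| / z.re := by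
      rw [norm_div, Complex.norm_real, Real.norm_eq_abs]
      calc |κ (n + 1)| / ‖w‖ ≤ |κ (n + 1)| / (z.re / 2) := by gcongr
        _ = 2 * |κ (n + 1)| / z.re := by field_simp
    refine ⟨?_, ?_⟩
    · rw [Metric.mem_closedBall, dist_eq_norm, add_sub_cancel_left]
      exact hbd
    · simp only [Set.mem_ofPred_eq, Complex.add_re]
      rcases le_or_gt 0 (κ (n + 1)) with h | h
      · have : 0 ≤ ((κ (n + 1) : ℂ) / w).re := by
          rw [Complex.div_re]
          simp only [Complex.ofReal_re, Complex.ofReal_im, zero_mul, zero_div, add_zero]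
          have : 0 ≤ w.re := by linarith
          have := Complex.normSq_nonneg w
          positivity
        linarith
      · have h1 : ‖(κ (n + 1) : ℂ) / w‖ ≤ z.re / 2 := by
          refine hbd.trans ?_
          rw [abs_of_neg h, div_le_iff₀ hz]
          nlinarith [hκ n]
        have h2 := (abs_le.1 ((Complex.abs_re_le_norm _).trans h1)).1
        linarith
  -- Sequences obeying the first m tail relations: nested nonempty compact sets, so Cantor's
  -- intersection theorem applies.
  let S : ℕ → Set (ℕ → ℂ) := fun m =>
    {w | (∀ n, w n ∈ K n) ∧ ∀ n < m, w n * w (n + 1) = z * w (n + 1) + κ (n + 1)}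
  have hSne : ∀ m, (S m).Nonempty := by
    intro m
    have hz0 : ∀ n, z ∈ K n := fun n =>
      ⟨Metric.mem_closedBall_self (by positivity), by simp only [Set.mem_ofPred_eq]; linarith⟩
    -- Start from the constant sequence z and fill in entries backwards from index m - 1.
    have : ∀ j ≤ m, ∃ w : ℕ → ℂ, (∀ n, w n ∈ K n) ∧
        ∀ n < m, m - j ≤ n → w n * w (n + 1) = z * w (n + 1) + κ (n + 1) := by
      intro j
      induction j with
      | zero => exact fun _ => ⟨fun _ => z, hz0, fun n h1 h2 => by omega⟩
      | succ j ih =>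
        intro hj
        obtain ⟨w, hw, hw'⟩ := ih (by omega)
        refine ⟨Function.update w (m - (j + 1))
          (z + κ (m - (j + 1) + 1) / w (m - (j + 1) + 1)), fun n => ?_, fun n h1 h2 => ?_⟩
        · by_cases hn : n = m - (j + 1)
          · subst hn
            rw [Function.update_self]
            exact hstep (hw _)
          · rw [Function.update_of_ne hn]
            exact hw n
        · rw [Function.update_of_ne (show n + 1 ≠ m - (j + 1) by omega)]
          by_cases hn : n = m - (j + 1)
          · subst hn
            rw [Function.update_self]
            have := hne (hw (m - (j + 1) + 1))
            field_simp
          · rw [Function.update_of_ne hn]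
            exact hw' n h1 (by omega)
    obtain ⟨w, hw, hw'⟩ := this m le_rfl
    exact ⟨w, hw, fun n hn => hw' n hn (by omega)⟩
  have hScl : ∀ m, IsClosed (S m) := by
    intro m
    refine IsClosed.inter (s₁ := {w : ℕ → ℂ | ∀ n, w n ∈ K n})
      (s₂ := {w : ℕ → ℂ | ∀ n < m, w n * w (n + 1) = z * w (n + 1) + κ (n + 1)}) ?_ ?_
    · simp only [Set.ofPred_forall]
      exact isClosed_iInter fun n => (hKc n).isClosed.preimage (continuous_apply n)
    · simp only [Set.ofPred_forall]
      refine isClosed_iInter fun n => isClosed_iInter fun _ => isClosed_eq ?_ ?_ <;> fun_prop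
  have hpi : IsCompact {w : ℕ → ℂ | ∀ n, w n ∈ K n} := isCompact_pi_infinite hKc
  obtain ⟨w, hw⟩ := IsCompact.nonempty_iInter_of_sequence_nonempty_isCompact_isClosed S
    (fun m w hw => ⟨hw.1, fun n hn => hw.2 n (by omega)⟩) hSne
    (hpi.of_isClosed_subset (hScl 0) fun w hw => hw.1) hScl
  rw [Set.mem_iInter] at hw
  have hwK := (hw 0).1
  have hw0 : ∀ n, w n ≠ 0 := fun n => hne (hwK n)
  have hwrec : ∀ n, w n * w (n + 1) = z * w (n + 1) + κ (n + 1) := fun n =>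
    (hw (n + 1)).2 n (by omega)
  have hu0 : ∀ n, (∏ j ∈ Finset.range n, w j)⁻¹ ≠ 0 := fun n =>
    inv_ne_zero (Finset.prod_ne_zero_iff.2 fun j _ => hw0 j)
  refine ⟨fun n => (∏ j ∈ Finset.range n, w j)⁻¹, fun n => ?_, hu0, fun n => ?_⟩
  · have h1 := hw0 n
    have h2 := hw0 (n + 1)
    have h3 := inv_ne_zero (hu0 n)
    rw [inv_inv] at h3
    simp only [Finset.prod_range_succ]
    field_simp
    linear_combination hwrec n
  · have h1 := hw0 n
    have h3 := inv_ne_zero (hu0 n)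
    rw [inv_inv] at h3
    have e : (∏ j ∈ Finset.range n, w j)⁻¹ / (∏ j ∈ Finset.range (n + 1), w j)⁻¹ = w n := by
      rw [Finset.prod_range_succ]
      field_simp
    simp only [e]
    have : z.re / 2 ≤ (w n).re := (hwK n).2
    linarith

/-! ### Approximants of `typeI` and bounds on κ -/

theorem typeI_get?_eq_some {a b : ℝ} {x : ℂ} {n : ℕ}
    (h : ∀ j, 1 ≤ j → j ≤ n → kappa a b j ≠ 0) :
    (typeI a b x).s.get? n = some ⟨typeINum a b n, x + (omegaPt a : ℂ)⟩ := by
  refine if_neg ?_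
  rintro ⟨k, hk, h0⟩
  cases k with
  | zero => simp [typeINum] at h0
  | succ k => exact h (k + 1) (by omega) hk (by simpa [typeINum] using h0)

theorem typeI_terminatedAt {a b : ℝ} {x : ℂ} {n : ℕ} (h : kappa a b (n + 1) = 0) :
    (typeI a b x).TerminatedAt (n + 1) :=
  if_pos ⟨n + 1, le_rfl, by simp [typeINum, h]⟩

theorem typeI_nums_dens {a b : ℝ} {x : ℂ} (n : ℕ)
    (h : ∀ j, 1 ≤ j → j < n → kappa a b j ≠ 0) :
    (typeI a b x).nums n = cfNum (x + (omegaPt a : ℂ)) (kappa a b) n ∧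
      (typeI a b x).dens n = cfDen (x + (omegaPt a : ℂ)) (kappa a b) n := by
  induction n using Nat.twoStepInduction with
  | zero =>
    rw [GenContFract.zeroth_num_eq_h, GenContFract.zeroth_den_eq_one]
    simp [cfNum, cfDen, linRec_zero, typeI, contFrac]
  | one =>
    have h0 : (typeI a b x).s.get? 0 = some ⟨typeINum a b 0, x + (omegaPt a : ℂ)⟩ :=
      typeI_get?_eq_some fun j h1 h2 => by omega
    rw [GenContFract.first_num_eq h0, GenContFract.first_den_eq h0]
    simp [cfNum, cfDen, linRec_one, typeI, contFrac, typeINum]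
  | more n ih1 ih2 =>
    obtain ⟨p1, q1⟩ := ih1 fun j h1 h2 => h j h1 (by omega)
    obtain ⟨p2, q2⟩ := ih2 fun j h1 h2 => h j h1 (by omega)
    have hs : (typeI a b x).s.get? (n + 1) =
        some ⟨typeINum a b (n + 1), x + (omegaPt a : ℂ)⟩ :=
      typeI_get?_eq_some fun j h1 h2 => h j h1 (by omega)
    rw [GenContFract.nums_recurrence hs p1 p2, GenContFract.dens_recurrence hs q1 q2]
    exact ⟨(linRec_add_two _ _ _ _ n).symm, (linRec_add_two _ _ _ _ n).symm⟩

theorem kappa_zero (a b : ℝ) : kappa a b 0 = 0 := by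
  simp [kappa]

theorem four_sq_sub_one_pos (n : ℕ) : 0 < 4 * (2 * ((n : ℝ) + 1) - 1) * (2 * ((n : ℝ) + 1) + 1) := by
  have : 0 ≤ (n : ℝ) := n.cast_nonneg
  have : 0 < 2 * ((n : ℝ) + 1) - 1 := by linarith
  positivity

theorem neg_abs_le_kappa (a b : ℝ) (n : ℕ) : -|a ^ 2 - 4 * b| ≤ kappa a b (n + 1) := by
  rw [kappa]
  push_cast
  rw [le_div_iff₀ (four_sq_sub_one_pos n)]
  have hn : 0 ≤ (n : ℝ) := n.cast_nonneg
  have h1 : -|a ^ 2 - 4 * b| ≤ ((n : ℝ) + 1) ^ 2 + 4 * b - a ^ 2 := by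
    linarith [le_abs_self (a ^ 2 - 4 * b), sq_nonneg ((n : ℝ) + 1)]
  have h2 := mul_le_mul_of_nonneg_left h1 (sq_nonneg ((n : ℝ) + 1))
  have h3 : ((n : ℝ) + 1) ^ 2 ≤ 4 * (2 * ((n : ℝ) + 1) - 1) * (2 * ((n : ℝ) + 1) + 1) := by
    nlinarith
  have h4 := mul_le_mul_of_nonneg_right h3 (abs_nonneg (a ^ 2 - 4 * b))
  linarith

theorem kappa_le (a b : ℝ) (n : ℕ) :
    kappa a b (n + 1) ≤ ((1 + |a ^ 2 - 4 * b|) * ((n : ℝ) + 1)) ^ 2 := by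
  rw [kappa]
  push_cast
  rw [div_le_iff₀ (four_sq_sub_one_pos n), mul_pow]
  have hn : 0 ≤ (n : ℝ) := n.cast_nonneg
  have h0 := abs_nonneg (a ^ 2 - 4 * b)
  set d := |a ^ 2 - 4 * b| with hd
  have h1 : ((n : ℝ) + 1) ^ 2 + 4 * b - a ^ 2 ≤ ((n : ℝ) + 1) ^ 2 + d := by
    linarith [neg_abs_le (a ^ 2 - 4 * b)]
  have h3 : ((n : ℝ) + 1) ^ 2 ≤ 4 * (2 * ((n : ℝ) + 1) - 1) * (2 * ((n : ℝ) + 1) + 1) := by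
    nlinarith
  have h4 : (1 : ℝ) ≤ ((n : ℝ) + 1) ^ 2 := by nlinarith
  calc ((n : ℝ) + 1) ^ 2 * (((n : ℝ) + 1) ^ 2 + 4 * b - a ^ 2)
      ≤ ((n : ℝ) + 1) ^ 2 * (((n : ℝ) + 1) ^ 2 * (1 + d) ^ 2) := by
        gcongr
        have := mul_nonneg h0 (sub_nonneg.2 h4)
        have := mul_nonneg (sq_nonneg d) (sq_nonneg ((n : ℝ) + 1))
        linarith
    _ = (1 + d) ^ 2 * ((n : ℝ) + 1) ^ 2 * ((n : ℝ) + 1) ^ 2 := by ring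
    _ ≤ _ := by gcongr

theorem eventually_kappa_pos (a b : ℝ) : ∀ᶠ n in atTop, 0 < kappa a b n := by
  have h : ∀ᶠ n : ℕ in atTop, 1 + |a ^ 2 - 4 * b| ≤ (n : ℝ) :=
    tendsto_natCast_atTop_atTop.eventually_ge_atTop _
  filter_upwards [h] with n hn
  have h0 := abs_nonneg (a ^ 2 - 4 * b)
  have h1 := le_abs_self (a ^ 2 - 4 * b)
  have h2 : 0 < 2 * (n : ℝ) - 1 := by linarith
  have h3 : 0 < (n : ℝ) ^ 2 + 4 * b - a ^ 2 := by nlinarith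
  have h4 : 0 < (n : ℝ) := by linarith
  rw [kappa]
  positivity

/-! ### Tails give values -/

/-- A backward solution whose ratios eventually lie in the closed right half-plane; it represents
the tails of the continued fraction. -/
structure IsTail (z : ℂ) (κ : ℕ → ℝ) (u : ℕ → ℂ) : Prop where
  backward : IsBackward z κ u
  zero_ne_zero : u 0 ≠ 0
  re_nonneg : ∀ᶠ n in atTop, u (n + 1) ≠ 0 ∧ 0 ≤ (u n / u (n + 1)).re

theorem IsTail.hasValue {a b : ℝ} {x : ℂ} {u : ℕ → ℂ}
    (hu : IsTail (x + (omegaPt a : ℂ)) (kappa a b) u)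
    (h : (∃ k, kappa a b (k + 1) = 0) ∨ 0 < (x + (omegaPt a : ℂ)).re) :
    HasValue (typeI a b x) (u 1 / u 0) := by
  by_cases hk : ∃ k, kappa a b (k + 1) = 0
  · classical
    have hk0 := Nat.find_spec hk
    have hmin : ∀ j, j < Nat.find hk → kappa a b (j + 1) ≠ 0 := fun j hj => Nat.find_min hk hj
    set k := Nat.find hk
    -- The initial numerator 1 has index 0, so approximant k + 1 uses exactly κ 1, …, κ k.
    have hnd := typeI_nums_dens (x := x) (k + 1) (a := a) (b := b) fun j h1 h2 => by
      have := hmin (j - 1) (by omega)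
      rwa [Nat.sub_add_cancel h1] at this
    have hval := hu.backward.cfDen_ne_zero_of_eq_zero hu.zero_ne_zero hk0
    have hterm := typeI_terminatedAt (x := x) hk0
    constructor
    · filter_upwards [eventually_ge_atTop (k + 1)] with n hn
      rw [GenContFract.dens_stable_of_terminated hn hterm, hnd.2]
      exact hval.1
    · refine tendsto_const_nhds.congr' ?_
      filter_upwards [eventually_ge_atTop (k + 1)] with n hn
      rw [GenContFract.convs_stable_of_terminated hn hterm, GenContFract.conv_eq_num_div_den,
        hnd.1, hnd.2, hval.2]
  · have hz := h.resolve_left hk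
    have hnd : ∀ n, _ := fun n => typeI_nums_dens (x := x) n (a := a) (b := b) fun j h1 _ h0 =>
      hk ⟨j - 1, by rwa [Nat.sub_add_cancel h1]⟩
    have hval := cfDen_ne_zero_and_tendsto hz (eventually_kappa_pos a b)
      (C := 1 + |a ^ 2 - 4 * b|) (by positivity) (kappa_le a b) hu.backward hu.zero_ne_zero
      hu.re_nonneg
    refine ⟨hval.1.mono fun n hn => by rwa [(hnd n).2], hval.2.congr fun n => ?_⟩
    rw [GenContFract.conv_eq_num_div_den, (hnd n).1, (hnd n).2]

/-! ### Contiguity between z + 1 and z -/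

/-- `x ^ 2 + a * x + b` in terms of `z = x + ω`. -/
noncomputable def poleQuad (a b : ℝ) (z : ℂ) : ℂ := (z + 1 / 2) ^ 2 - ((a : ℂ) ^ 2 - 4 * b) / 4

theorem poleQuad_add_omegaPt (a b : ℝ) (x : ℂ) :
    poleQuad a b (x + (omegaPt a : ℂ)) = x ^ 2 + (a : ℂ) * x + (b : ℂ) := by
  simp only [poleQuad, omegaPt]
  push_cast
  ring

/-- The coefficients of the contiguity relation between the tails at `z + 1` and at `z`. -/
noncomputable def shiftCoeff (a b : ℝ) (z : ℂ) (n : ℕ) : ℂ :=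
  poleQuad a b z + n * z + n * (n + 1) / 2

noncomputable def shiftCoeff' (a b : ℝ) (z : ℂ) (n : ℕ) : ℂ :=
  poleQuad a b z - n * z + n * (n - 1) / 2

/-- The tail at `z` obtained from a tail `u` at `z + 1`. -/
noncomputable def shiftTail (a b : ℝ) (z : ℂ) (u : ℕ → ℂ) (n : ℕ) : ℂ :=
  shiftCoeff a b z n * u n + (2 * n - 1) * (kappa a b n : ℂ) * u (n + 1)

theorem kappa_mul (a b : ℝ) (n : ℕ) :
    4 * (2 * (n : ℂ) - 1) * (2 * (n : ℂ) + 1) * (kappa a b n : ℂ) =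
      (n : ℂ) ^ 2 * ((n : ℂ) ^ 2 + 4 * b - (a : ℂ) ^ 2) := by
  have h1 : (2 * (n : ℝ) - 1) ≠ 0 := by
    intro h
    have : ((2 * n : ℕ) : ℝ) = ((1 : ℕ) : ℝ) := by push_cast; linarith
    have := Nat.cast_injective this
    omega
  have h2 : (2 * (n : ℝ) + 1) ≠ 0 := by positivity
  have : 4 * (2 * (n : ℝ) - 1) * (2 * (n : ℝ) + 1) * kappa a b n =
      (n : ℝ) ^ 2 * ((n : ℝ) ^ 2 + 4 * b - a ^ 2) := by
    rw [kappa]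
    field_simp
  exact_mod_cast congrArg (fun t : ℝ => (t : ℂ)) this

theorem shiftTail_succ {a b : ℝ} {z : ℂ} {u : ℕ → ℂ} (hu : IsBackward (z + 1) (kappa a b) u)
    (n : ℕ) : shiftTail a b z u (n + 1) =
      (2 * n + 1) * u n + shiftCoeff' a b z n * u (n + 1) := by
  rw [hu n]
  simp only [shiftTail, shiftCoeff, shiftCoeff']
  push_cast
  ring

/-- In terms of u (n+1) and u (n+2), the latter's coefficients cancel; the former's agree by the
closed forms of κ n and κ (n+1), once multiplied by 2n + 1. -/
theorem isBackward_shiftTail {a b : ℝ} {z : ℂ} {u : ℕ → ℂ}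
    (hu : IsBackward (z + 1) (kappa a b) u) : IsBackward z (kappa a b) (shiftTail a b z u) := by
  intro n
  rw [shiftTail_succ hu (n + 1), shiftTail_succ hu n, shiftTail, hu n]
  have h0 := kappa_mul a b n
  have h1 := kappa_mul a b (n + 1)
  simp only [shiftCoeff, shiftCoeff', poleQuad]
  push_cast at h1 ⊢
  have hd : (2 * (n : ℂ) + 1) ≠ 0 := by
    have : ((2 * n + 1 : ℕ) : ℂ) ≠ 0 := Nat.cast_ne_zero.2 (by omega)
    exact_mod_cast this
  refine mul_left_cancel₀ hd ?_
  linear_combination (u (n + 1) / 4) * h0 - (u (n + 1) / 4) * h1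

theorem IsTail.shift {a b : ℝ} {z : ℂ} {u : ℕ → ℂ} (hu : IsTail (z + 1) (kappa a b) u)
    (hq : poleQuad a b z ≠ 0) : IsTail z (kappa a b) (shiftTail a b z u) ∧
      shiftTail a b z u 1 / shiftTail a b z u 0 = u 1 / u 0 + 1 / poleQuad a b z := by
  have hu0 := hu.zero_ne_zero
  have h0 : shiftTail a b z u 0 = poleQuad a b z * u 0 := by
    simp [shiftTail, shiftCoeff, kappa_zero]
  have h1 : shiftTail a b z u 1 = u 0 + poleQuad a b z * u 1 := by
    rw [show (1 : ℕ) = 0 + 1 from rfl, shiftTail_succ hu.backward 0]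
    simp [shiftCoeff']
  refine ⟨⟨isBackward_shiftTail hu.backward, ?_, ?_⟩, ?_⟩
  · rw [h0]
    exact mul_ne_zero hq hu0
  · set q := poleQuad a b z with hqdef
    -- Large enough for both `hC` and `hD`.
    have hn : ∀ᶠ n : ℕ in atTop, 1 + ‖q‖ + ‖q‖ ^ 2 + 2 * (1 + ‖z‖) ≤ (n : ℝ) :=
      tendsto_natCast_atTop_atTop.eventually_ge_atTop _
    filter_upwards [hu.re_nonneg, hn] with n hpos hn
    obtain ⟨hne, hre⟩ := hpos
    have hq0 := norm_nonneg q
    have hz0 := norm_nonneg z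
    have hqre := (abs_le.1 (Complex.abs_re_le_norm q)).1
    have hzre := abs_le.1 (Complex.abs_re_le_norm z)
    have hn1 : (1 : ℝ) ≤ n := by nlinarith [sq_nonneg ‖q‖]
    have hC : ‖q‖ ^ 2 ≤ (shiftCoeff a b z n).re := by
      have e : shiftCoeff a b z n = q + ((n : ℝ) : ℂ) * z + (((n : ℝ) * (n + 1) / 2 : ℝ) : ℂ) := by
        rw [shiftCoeff]; push_cast; rfl
      rw [e, Complex.add_re, Complex.add_re, Complex.re_ofReal_mul, Complex.ofReal_re]
      have : (n : ℝ) * (-‖z‖) ≤ n * z.re := by gcongr; exact hzre.1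
      nlinarith [sq_nonneg ‖q‖]
    have hD : 1 ≤ (shiftCoeff' a b z n).re := by
      have e : shiftCoeff' a b z n = q - ((n : ℝ) : ℂ) * z + (((n : ℝ) * (n - 1) / 2 : ℝ) : ℂ) := by
        rw [shiftCoeff']; push_cast; rfl
      rw [e, Complex.add_re, Complex.sub_re, Complex.re_ofReal_mul, Complex.ofReal_re]
      have : (n : ℝ) * z.re ≤ n * ‖z‖ := by gcongr; exact hzre.2
      nlinarith [sq_nonneg ‖q‖]
    set c : ℝ := 2 * n + 1 with hc
    have hc0 : 0 < c := by positivity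
    set v := u n / u (n + 1) with hv
    have hun : u n = v * u (n + 1) := by rw [hv]; field_simp
    set w := (c : ℂ) * v + shiftCoeff' a b z n with hw
    have hwre : 1 ≤ w.re := by
      rw [hw, Complex.add_re, Complex.re_ofReal_mul]
      have := mul_nonneg hc0.le hre
      linarith
    have hwn : 1 ≤ ‖w‖ := hwre.trans (Complex.re_le_norm w)
    have hw0 : w ≠ 0 := norm_pos_iff.1 (by linarith)
    have hs : shiftTail a b z u (n + 1) = w * u (n + 1) := by
      rw [shiftTail_succ hu.backward, hun, hw, hc]
      push_cast
      ring
    refine ⟨by rw [hs]; exact mul_ne_zero hw0 hne, ?_⟩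
    have hcC : (c : ℂ) ≠ 0 := Complex.ofReal_ne_zero.2 hc0.ne'
    -- The shift matrix has determinant q²: `shiftCoeff` * `shiftCoeff'` = q² + (4n² - 1) κ n.
    have e : shiftTail a b z u n / shiftTail a b z u (n + 1) =
        (shiftCoeff a b z n - q ^ 2 / w) / (c : ℂ) := by
      rw [hs, shiftTail, hun]
      field_simp
      have hk := kappa_mul a b n
      have hq2 : q = (z + 1 / 2) ^ 2 - ((a : ℂ) ^ 2 - 4 * b) / 4 := rfl
      rw [hw, hc]
      simp only [shiftCoeff, shiftCoeff', ← hqdef]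
      push_cast
      linear_combination hk / 4 - (n : ℂ) ^ 2 * hq2
    rw [e, Complex.div_ofReal_re, Complex.sub_re]
    refine div_nonneg ?_ hc0.le
    have : ‖q ^ 2 / w‖ ≤ ‖q‖ ^ 2 := by
      rw [norm_div, norm_pow]
      exact div_le_self (sq_nonneg _) hwn
    have := (Complex.re_le_norm _).trans this
    linarith
  · rw [h0, h1]
    field_simp
    ring

/-! ### Descent from far right, and conclusion -/

theorem exists_isTail {a b : ℝ} (z : ℂ) (hq : ∀ j : ℕ, poleQuad a b (z + j) ≠ 0) :
    ∃ u, IsTail z (kappa a b) u := by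
  -- With d = |a² - 4b|, Re (z + m) ≥ 1 + 4d gives Re (z + m)² / 4 ≥ d, as `exists_isBackward`
  -- needs.
  obtain ⟨m, hm⟩ := exists_nat_ge (1 + 4 * |a ^ 2 - 4 * b| - z.re)
  have h0 := abs_nonneg (a ^ 2 - 4 * b)
  have hre : 1 + 4 * |a ^ 2 - 4 * b| ≤ (z + m).re := by
    rw [Complex.add_re, Complex.natCast_re]
    linarith
  have hfar : ∃ u, IsTail (z + m) (kappa a b) u := by
    obtain ⟨u, h1, h2, h3⟩ := exists_isBackward (z := z + m) (κ := kappa a b) (by linarith)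
      fun n => le_trans (by nlinarith) (neg_abs_le_kappa a b n)
    exact ⟨u, h1, h2 0, Eventually.of_forall fun n => ⟨h2 _, h3 n⟩⟩
  clear hm hre
  induction m with
  | zero => simpa using hfar
  | succ m ih =>
    obtain ⟨u, hu⟩ := hfar
    rw [Nat.cast_succ, ← add_assoc] at hu
    exact ih ⟨_, (hu.shift (hq m)).1⟩

theorem HasValue.F_eq {a b : ℝ} {x τ : ℂ} (h : HasValue (typeI a b x) τ) : F a b x = τ :=
  h.2.limUnder_eq

theorem theorem1 (a b : ℝ) (x : ℂ)
    (hx : ∀ (q : ℤ) (α : ℂ), q ≤ 0 → α ^ 2 + (a : ℂ) * α + (b : ℂ) = 0 → x ≠ (q : ℂ) + α)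
    (h : (∃ k : ℕ, 0 < k ∧ Real.sqrt (a ^ 2 - 4 * b) = (k : ℝ)) ∨ -omegaPt a < x.re) :
    HasValue (typeI a b x) (F a b x) ∧
    HasValue (typeI a b (x + 1)) (F a b (x + 1)) ∧
    F a b x - F a b (x + 1) = 1 / (x ^ 2 + (a : ℂ) * x + (b : ℂ)) := by
  have hq : ∀ j : ℕ, poleQuad a b (x + (omegaPt a : ℂ) + j) ≠ 0 := by
    intro j h0
    rw [add_right_comm, poleQuad_add_omegaPt] at h0
    -- A zero at shift j makes x + j a root α, so x = -j + α.
    refine hx (-(j : ℤ)) (x + j) (by omega) h0 ?_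
    push_cast
    ring
  have hq0 : poleQuad a b (x + (omegaPt a : ℂ)) ≠ 0 := by simpa using hq 0
  obtain ⟨u, hu⟩ := exists_isTail (x + (omegaPt a : ℂ) + 1) fun j => by
    have := hq (j + 1)
    push_cast at this
    rwa [add_assoc, add_comm 1 (j : ℂ)]
  obtain ⟨hs, he⟩ := hu.shift hq0
  have hkr : (∃ k, kappa a b (k + 1) = 0) ∨ 0 < (x + (omegaPt a : ℂ)).re := by
    refine h.imp ?_ fun h => ?_
    · rintro ⟨k, hk, hs⟩
      -- κ k vanishes for k² = a² - 4b.
      refine ⟨k - 1, ?_⟩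
      have hk' : (0 : ℝ) < k := Nat.cast_pos.2 hk
      have hD := (Real.sqrt_eq_iff_mul_self_eq_of_pos hk').1 hs
      rw [Nat.sub_add_cancel hk, kappa, show (k : ℝ) ^ 2 + 4 * b - a ^ 2 = 0 by rw [pow_two]; linarith]
      simp
    · rw [Complex.add_re, Complex.ofReal_re]
      linarith
  have hv := hs.hasValue hkr
  rw [add_right_comm] at hu
  have hv' := hu.hasValue (hkr.imp_right fun h => by
    rw [add_right_comm, Complex.add_re, Complex.one_re]
    linarith)
  rw [hv.F_eq, hv'.F_eq]
  refine ⟨hv, hv', ?_⟩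
  rw [he, poleQuad_add_omegaPt]
  ring
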